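/- Let $S$ and $A$ be sets with $|S|=|A|=2$. Consider a nonlocal game $\mathcal G$ in which both players have question set $S$ and answer set $A$, given by a probability distribution $\pi$ on $S\times S$ and a predicate $V:A\times A\times S\times S\to\{0,1\}$. The winning probability of a correlation $p=(p(a,b|s,t))$ is $\sum_{s,t}\pi(s,t)\sum_{a,b}V(a,b|s,t)\,p(a,b|s,t)$. A correlation ($p\ge 0$, $\sum_{a,b}p(a,b|s,t)=1$ for all $s,t$) is synchronous if $p(a,a'|s,s)=0$ for all $s$ and all $a\ne a'$. Let $\mathcal{CP}^n$ be the cone of Gram matrices of $n$ entrywise nonnegative real vectors, $\mathcal{CS}_+^n$ the cone of Gram matrices (for $\langle P,Q\rangle=\mathrm{Tr}(PQ)$) of $n$ real symmetric positive semidefinite matrices of a common size, and $\mathcal{DNN}^n$ the cone of $n\times n$ positive semidefinite, entrywise nonnegative matrices. For $\mathcal K\in\{\mathcal{CP},\mathcal{CS}_+\}$, a $\mathcal K$-correlation is a vector $p$ for which there is $X\in\mathcal K^{2|S||A|}$, with rows and columns indexed by two disjoint copies of $S\times A$ (one per player), such that each block of $X$ indexed by an ordered pair of questions (each taken from either copy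 of $S$) has entry sum $1$ and $X[(s,a),(t,b)]=p(a,b|s,t)$ for $(s,a)$ in the first and $(t,b)$ in the second copy. Let $\omega_{syn}(\mathcal K,\mathcal G)$ be the supremum of the winning probability over synchronous $\mathcal K$-correlations. With $C[(s,a),(t,b)]=\pi(s,t)V(a,b|s,t)$, let $\nu(\mathcal{DNN},\mathcal G)$ be the supremum of $\tfrac12\langle C+C^{\mathsf T},X\rangle$ over $X\in\mathcal{DNN}^{|S\times A|}$ such that $\sum_{a,a'}X[(s,a),(s',a')]=1$ for all $s,s'\in S$ and $X[(s,a),(s,a')]=0$ for all $s\in S$, $a\ne a'\in A$. Then $$\omega_{syn}(\mathcal{CP},\mathcal G)=\omega_{syn}(\mathcal{CS}_+,\mathcal G)=\nu(\mathcal{DNN},\mathcal G).$$ Moreover, the supremum of the winning probability over synchronous classical correlations ($p(a,b|s,t)=\sum_{i=1}^n k_i x^{s,i}_a y^{t,i}_b$ for a probability vector $(k_i)$ and probability distributions $x^{s,i},y^{t,i}$ on $A$) and the supremum over synchronous quantum correlations ($p(a,b|s,t)=\psi^*(X^s_a\otimes Y^t_b)\psi$ for a unit vector $\psi$ in a tensor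 product of two finite-dimensional complex Euclidean spaces and Hermitian positive semidefinite operators with $\sum_aX^s_a=I$ and $\sum_bY^t_b=I$) are both equal to $\nu(\mathcal{DNN},\mathcal G)$. All five suprema are attained. For the CHSH game ($S=A=\{0,1\}$, $\pi$ uniform, $V(a,b|s,t)=1$ if and only if $a\oplus b=s\cdot t$) the synchronous quantum value is $3/4$, both as the supremum over synchronous quantum correlations and as $\omega_{syn}(\mathcal{CS}_+,\cdot)$, and the synchronous classical value (the supremum over synchronous classical correlations) is also $3/4$. -/

import Mathlib

open scoped Matrix Kronecker ComplexOrder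

noncomputable section

/-- A two-player one-round nonlocal game with question sets `S`, `T` and answer sets `A`, `B`:
a probability distribution `π` on `S × T` and a Boolean predicate `V` (`V a b s t` is
`V(a,b|s,t)`). -/
structure NonlocalGame (S T A B : Type*) [Fintype S] [Fintype T] where
  π : S → T → ℝ
  V : A → B → S → T → Bool
  π_nonneg : ∀ s t, 0 ≤ π s t
  π_sum : ∑ s, ∑ t, π s t = 1

namespace NonlocalGame

section Cones

variable (ι : Type*)

/-- The completely positive cone: Gram matrices of entrywise nonnegative real vectors. -/
def completelyPositive : Set (Matrix ι ι ℝ) :=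
  {X | ∃ d : ℕ, 1 ≤ d ∧ ∃ x : ι → Fin d → ℝ,
    (∀ i k, 0 ≤ x i k) ∧ ∀ i j, X i j = x i ⬝ᵥ x j}

/-- The completely positive semidefinite cone: Gram matrices, for the inner product
`⟨P, Q⟩ = Tr (P Q)`, of real symmetric positive semidefinite matrices. -/
def completelyPSD : Set (Matrix ι ι ℝ) :=
  {X | ∃ d : ℕ, 1 ≤ d ∧ ∃ P : ι → Matrix (Fin d) (Fin d) ℝ,
    (∀ i, (P i).PosSemidef) ∧ ∀ i j, X i j = (P i * P j).trace}

/-- The doubly nonnegative cone: positive semidefinite and entrywise nonnegative matrices. -/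
def doublyNonneg : Set (Matrix ι ι ℝ) :=
  {X | X.PosSemidef ∧ ∀ i j, 0 ≤ X i j}

end Cones

section Correlations

variable (S T A B : Type*) [Fintype A] [Fintype B]

/-- The set of all correlations; `p a b s t` stands for `p(a,b|s,t)`. -/
def correlations : Set (A → B → S → T → ℝ) :=
  {p | (∀ a b s t, 0 ≤ p a b s t) ∧ ∀ s t, ∑ a, ∑ b, p a b s t = 1}

/-- Classical correlations: those generated with shared and private randomness. -/
def classicalCorrelations : Set (A → B → S → T → ℝ) :=
  {p | ∃ (n : ℕ) (k : Fin n → ℝ) (x : S → Fin n → A → ℝ) (y : T → Fin n → B → ℝ),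
    (∀ i, 0 ≤ k i) ∧ (∀ s i a, 0 ≤ x s i a) ∧ (∀ t i b, 0 ≤ y t i b) ∧
    ∑ i, k i = 1 ∧ (∀ s i, ∑ a, x s i a = 1) ∧ (∀ t i, ∑ b, y t i b = 1) ∧
    ∀ a b s t, p a b s t = ∑ i, k i * x s i a * y t i b}

/-- Quantum correlations: those generated by local measurements on a shared pure state `ψ` in a
tensor product `ℂ^m ⊗ ℂ^n` of finite dimensional complex Euclidean spaces. -/
def quantumCorrelations : Set (A → B → S → T → ℝ) :=
  {p | ∃ (m n : ℕ) (ψ : Fin m × Fin n → ℂ)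
      (X : S → A → Matrix (Fin m) (Fin m) ℂ) (Y : T → B → Matrix (Fin n) (Fin n) ℂ),
    star ψ ⬝ᵥ ψ = 1 ∧
    (∀ s a, (X s a).PosSemidef) ∧ (∀ s, ∑ a, X s a = 1) ∧
    (∀ t b, (Y t b).PosSemidef) ∧ (∀ t, ∑ b, Y t b = 1) ∧
    ∀ a b s t, (p a b s t : ℂ) = star ψ ⬝ᵥ ((X s a ⊗ₖ Y t b) *ᵥ ψ)}

variable {S T A B}

/-- The sum `⟨J_{i,j}, X⟩` of all entries in the block `(i,j)`, `i, j ∈ S ∪ T` (disjoint union),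
of a square matrix with rows and columns indexed by `S × A` and `T × B`. -/
def blockSum (X : Matrix ((S × A) ⊕ (T × B)) ((S × A) ⊕ (T × B)) ℝ) : S ⊕ T → S ⊕ T → ℝ
  | .inl s, .inl s' => ∑ a, ∑ a', X (.inl (s, a)) (.inl (s', a'))
  | .inl s, .inr t => ∑ a, ∑ b, X (.inl (s, a)) (.inr (t, b))
  | .inr t, .inl s => ∑ b, ∑ a, X (.inr (t, b)) (.inl (s, a))
  | .inr t, .inr t' => ∑ b, ∑ b', X (.inr (t, b)) (.inr (t', b'))

/-- The set `Corr(K)` of `K`-correlations. -/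
def conicCorrelations (K : Set (Matrix ((S × A) ⊕ (T × B)) ((S × A) ⊕ (T × B)) ℝ)) :
    Set (A → B → S → T → ℝ) :=
  {p | ∃ X ∈ K, (∀ i j, blockSum X i j = 1) ∧
    ∀ a b s t, X (.inl (s, a)) (.inr (t, b)) = p a b s t}

variable (S A) in
/-- Synchronous correlations (`S = T`, `A = B`): equal questions never get distinct answers. -/
def synchronousCorrelations : Set (A → A → S → S → ℝ) :=
  {p | p ∈ correlations S S A A ∧ ∀ s a a', a ≠ a' → p a a' s s = 0}

end Correlations

section Values

variable {S T A B : Type*} [Fintype S] [Fintype T] [Fintype A] [Fintype B]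

/-- The probability of winning `G` with a strategy that generates the correlation `p`. -/
def winProb (G : NonlocalGame S T A B) (p : A → B → S → T → ℝ) : ℝ :=
  ∑ s, ∑ t, G.π s t * ∑ a, ∑ b, (if G.V a b s t then 1 else 0) * p a b s t

/-- The winning probabilities achieved by the synchronous correlations in the set `𝒮`. -/
def syncWinProbs (G : NonlocalGame S S A A) (𝒮 : Set (A → A → S → S → ℝ)) : Set ℝ :=
  G.winProb '' (𝒮 ∩ synchronousCorrelations S A)

/-- The value of `G` when only synchronous correlations in the set `𝒮` may be used. -/
def syncValue (G : NonlocalGame S S A A) (𝒮 : Set (A → A → S → S → ℝ)) : ℝ :=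
  sSup (G.syncWinProbs 𝒮)

/-- The `K`-synchronous value, for a cone `K` of matrices indexed by two copies of `S × A`. -/
def conicSyncValue (K : Set (Matrix ((S × A) ⊕ (S × A)) ((S × A) ⊕ (S × A)) ℝ))
    (G : NonlocalGame S S A A) : ℝ :=
  G.syncValue (conicCorrelations K)

/-- The cost matrix `C[(s,a),(t,b)] = π(s,t) V(a,b|s,t)`. -/
def costMatrix (G : NonlocalGame S T A B) : Matrix (S × A) (T × B) ℝ :=
  Matrix.of fun i j => G.π i.1 j.1 * (if G.V i.2 j.2 i.1 j.1 then 1 else 0)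

/-- The objective values at the feasible points of the conic program `ν(K, G)`. -/
def nuValues (K : Set (Matrix (S × A) (S × A) ℝ)) (G : NonlocalGame S S A A) : Set ℝ :=
  (fun X => (1 / 2 : ℝ) * ((G.costMatrix + G.costMatrixᵀ) * X).trace) ''
    {X | X ∈ K ∧ (∀ s s', ∑ a, ∑ a', X (s, a) (s', a') = 1) ∧
      ∀ s a a', a ≠ a' → X (s, a) (s, a') = 0}

/-- The optimal value `ν(K, G)` of that program. -/
def nu (K : Set (Matrix (S × A) (S × A) ℝ)) (G : NonlocalGame S S A A) : ℝ :=
  sSup (nuValues K G)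

end Values

/-- The CHSH game: uniform questions, and the players win iff `a ⊕ b = s · t`. -/
def chsh : NonlocalGame Bool Bool Bool Bool where
  π := fun _ _ => 1 / 4
  V := fun a b s t => xor a b == (s && t)
  π_nonneg := by intros; norm_num
  π_sum := by norm_num

end NonlocalGame

end

open NonlocalGame

/-!
A synchronous correlation of any of the four kinds is `⟪x (s, a), y (t, b)⟫` for vectors with
`∑ a, ‖x (s, a)‖² ≤ 1` and `∑ b, ‖y (t, b)‖² ≤ 1`. Since `∑ a, p(a,a|s,s) = 1`, equality in
Cauchy-Schwarz forces `x = y`, so `p` is a Gram matrix, that is, a feasible point of the program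
`ν` over the doubly nonnegative cone.

The vectors `∑ a, x (s, a)` then have pairwise inner products `1`, hence coincide, and the row sums
`∑ b, p(a,b|s,t) = p(a,a|s,s)` do not depend on `t`. With two questions `s₀` and `s₁` this makes
`p` the mixture, with weights `p(a,b|s₀,s₁)`, of the deterministic strategies answering `a` to `s₀`
and `b` to `s₁`. All values therefore equal the best deterministic one.
-/

namespace NonlocalGame

section Kronecker

variable {R l m n o α : Type*} [CommSemiring R] [Fintype α]

lemma sum_kronecker (M : α → Matrix l m R) (N : Matrix n o R) :
    (∑ a, M a) ⊗ₖ N = ∑ a, M a ⊗ₖ N :=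
  LinearMap.map_sum₂ (Matrix.kroneckerBilinear (R := R) (α := R)) _ _ _

lemma kronecker_sum (M : Matrix l m R) (N : α → Matrix n o R) :
    M ⊗ₖ ∑ a, N a = ∑ a, M ⊗ₖ N a :=
  map_sum (Matrix.kroneckerBilinear (R := R) (α := R) M) _ _

end Kronecker

section PosSemidef

variable {𝕜 ι : Type*} [RCLike 𝕜] [Fintype ι]

open scoped MatrixOrder in
lemma exists_gram_eq_of_posSemidef {X : Matrix ι ι 𝕜} (hX : X.PosSemidef) :
    ∃ v : ι → EuclideanSpace 𝕜 ι, Matrix.gram 𝕜 v = X := by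
  classical
  obtain ⟨B, rfl⟩ := CStarAlgebra.nonneg_iff_eq_star_mul_self.mp hX.nonneg
  refine ⟨fun i => WithLp.toLp 2 (B.col i), ?_⟩
  ext i j
  simp [EuclideanSpace.inner_toLp_toLp, Matrix.mul_apply, dotProduct, mul_comm]

open scoped MatrixOrder in
lemma trace_mul_nonneg_of_posSemidef {P Q : Matrix ι ι 𝕜} (hP : P.PosSemidef)
    (hQ : Q.PosSemidef) : 0 ≤ (P * Q).trace := by
  classical
  obtain ⟨B, rfl⟩ := CStarAlgebra.nonneg_iff_eq_star_mul_self.mp hP.nonneg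
  rw [Matrix.star_eq_conjTranspose, Matrix.mul_assoc, Matrix.trace_mul_comm]
  exact (hQ.mul_mul_conjTranspose_same B).trace_nonneg

variable [DecidableEq ι]

lemma posSemidef_sub_mul_self {M : Matrix ι ι 𝕜} (hM : M.PosSemidef)
    (hM1 : (1 - M).PosSemidef) : (M - M * M).PosSemidef := by
  have hsum := (hM1.conjTranspose_mul_mul_same M).add (hM.conjTranspose_mul_mul_same (1 - M))
  rw [hM.isHermitian.eq, hM1.isHermitian.eq] at hsum
  convert hsum using 1
  noncomm_ring

lemma sum_norm_sq_mulVec_le {α : Type*} [Fintype α] {M : α → Matrix ι ι 𝕜}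
    (hM : ∀ a, (M a).PosSemidef) (hM1 : ∑ a, M a = 1) (ψ : ι → 𝕜) :
    ∑ a, ‖WithLp.toLp 2 (M a *ᵥ ψ)‖ ^ 2 ≤ ‖WithLp.toLp 2 ψ‖ ^ 2 := by
  classical
  have hcompl (a : α) : (1 - M a).PosSemidef := by
    rw [← hM1, ← Finset.sum_erase_eq_sub (Finset.mem_univ a)]
    exact Matrix.posSemidef_sum _ fun b _ => hM b
  have hterm (a : α) : ‖WithLp.toLp 2 (M a *ᵥ ψ)‖ ^ 2 ≤ RCLike.re (star ψ ⬝ᵥ (M a *ᵥ ψ)) := by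
    have h := (posSemidef_sub_mul_self (hM a) (hcompl a)).re_dotProduct_nonneg ψ
    rw [Matrix.sub_mulVec, dotProduct_sub, map_sub, sub_nonneg] at h
    refine le_of_eq_of_le ?_ h
    rw [← inner_self_eq_norm_sq (𝕜 := 𝕜), EuclideanSpace.inner_toLp_toLp, dotProduct_comm,
      Matrix.star_mulVec, (hM a).isHermitian.eq, ← Matrix.dotProduct_mulVec, Matrix.mulVec_mulVec]
  calc ∑ a, ‖WithLp.toLp 2 (M a *ᵥ ψ)‖ ^ 2
      ≤ ∑ a, RCLike.re (star ψ ⬝ᵥ (M a *ᵥ ψ)) := Finset.sum_le_sum fun a _ => hterm a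
    _ = RCLike.re (star ψ ⬝ᵥ ((∑ a, M a) *ᵥ ψ)) := by
        rw [Matrix.sum_mulVec, dotProduct_sum, map_sum]
    _ = ‖WithLp.toLp 2 ψ‖ ^ 2 := by
        rw [hM1, Matrix.one_mulVec, ← inner_self_eq_norm_sq (𝕜 := 𝕜),
          EuclideanSpace.inner_toLp_toLp, dotProduct_comm]

end PosSemidef

section InnerProductSpace

variable {α E : Type*} [Fintype α] [NormedAddCommGroup E] [InnerProductSpace ℝ E]

lemma eq_of_sum_norm_sq_le_one_of_sum_inner_eq_one {x y : α → E} (hx : ∑ a, ‖x a‖ ^ 2 ≤ 1)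
    (hy : ∑ a, ‖y a‖ ^ 2 ≤ 1) (hxy : ∑ a, inner ℝ (x a) (y a) = 1) : x = y := by
  have hdist : ∑ a, ‖x a - y a‖ ^ 2 ≤ 0 := by
    simp only [norm_sub_sq_real, Finset.sum_add_distrib, Finset.sum_sub_distrib,
      ← Finset.mul_sum, hxy]
    linarith
  have hzero := (Finset.sum_eq_zero_iff_of_nonneg fun a _ => sq_nonneg ‖x a - y a‖).1
    (hdist.antisymm (Finset.sum_nonneg fun a _ => sq_nonneg _))
  funext a
  simpa [sub_eq_zero] using hzero a (Finset.mem_univ a)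

end InnerProductSpace

section Cones

variable {ι : Type*}

lemma completelyPositive_subset_completelyPSD : completelyPositive ι ⊆ completelyPSD ι := by
  rintro X ⟨d, hd, x, hx, hX⟩
  refine ⟨d, hd, fun i => Matrix.diagonal (x i), fun i => .diagonal (hx i), fun i j => ?_⟩
  rw [hX, Matrix.diagonal_mul_diagonal, Matrix.trace_diagonal, dotProduct]

lemma completelyPSD_subset_doublyNonneg [Finite ι] : completelyPSD ι ⊆ doublyNonneg ι := by
  rintro X ⟨d, -, P, hP, hX⟩
  refine ⟨?_, fun i j => hX i j ▸ trace_mul_nonneg_of_posSemidef (hP i) (hP j)⟩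
  have hgram : X = Matrix.gram ℝ fun i => WithLp.toLp 2 (Function.uncurry (P i)) := by
    ext i j
    have hsymm (k l : Fin d) : P j l k = P j k l := (hP j).isHermitian.apply k l
    simp [hX, Matrix.trace, Matrix.mul_apply, EuclideanSpace.inner_toLp_toLp, dotProduct,
      Fintype.sum_prod_type, Function.uncurry, hsymm, mul_comm]
  exact hgram ▸ Matrix.posSemidef_gram ℝ _

end Cones

section Correlations

variable {S T A B : Type*} [Fintype A] [Fintype B]

lemma conicCorrelations_mono
    {K L : Set (Matrix ((S × A) ⊕ (T × B)) ((S × A) ⊕ (T × B)) ℝ)} (h : K ⊆ L) :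
    conicCorrelations K ⊆ conicCorrelations L :=
  fun _ ⟨X, hX, hp⟩ => ⟨X, h hX, hp⟩

lemma blockSum_gram_eq_one {n : Type*} [Fintype n] {x : S → A → n → ℝ} {y : T → B → n → ℝ}
    {w : n → ℝ} (hw : w ⬝ᵥ w = 1) (hx : ∀ s, ∑ a, x s a = w) (hy : ∀ t, ∑ b, y t b = w)
    (i j : S ⊕ T) :
    blockSum (.of fun i j => Sum.elim (Function.uncurry x) (Function.uncurry y) i ⬝ᵥ
      Sum.elim (Function.uncurry x) (Function.uncurry y) j) i j = 1 := by
  rcases i with s | t <;> rcases j with s' | t' <;>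
    simp [blockSum, ← dotProduct_sum, ← sum_dotProduct, hx, hy, hw]

lemma classicalCorrelations_subset_conicCorrelations_completelyPositive :
    classicalCorrelations S T A B ⊆ conicCorrelations (completelyPositive _) := by
  rintro p ⟨n, k, x, y, hk, hx, hy, hk1, hx1, hy1, hp⟩
  have hn : 1 ≤ n := by
    refine Nat.one_le_iff_ne_zero.2 ?_
    rintro rfl
    simp at hk1
  have hsq (i : Fin n) : √(k i) * √(k i) = k i := Real.mul_self_sqrt (hk i)
  refine ⟨_, ⟨n, hn, Sum.elim (Function.uncurry fun s a i => √(k i) * x s i a)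
    (Function.uncurry fun t b i => √(k i) * y t i b), ?_, fun _ _ => rfl⟩,
    blockSum_gram_eq_one (w := fun i => √(k i)) ?_ (fun s => ?_) fun t => ?_, fun a b s t => ?_⟩
  · rintro (⟨s, a⟩ | ⟨t, b⟩) i
    · exact mul_nonneg (Real.sqrt_nonneg _) (hx s i a)
    · exact mul_nonneg (Real.sqrt_nonneg _) (hy t i b)
  · simpa only [dotProduct, hsq] using hk1
  · ext i
    rw [Finset.sum_apply, ← Finset.mul_sum, hx1, mul_one]
  · ext i
    rw [Finset.sum_apply, ← Finset.mul_sum, hy1, mul_one]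
  · rw [hp]
    change ∑ i, √(k i) * x s i a * (√(k i) * y t i b) = _
    exact Finset.sum_congr rfl fun i _ => by linear_combination x s i a * y t i b * hsq i

end Correlations

section PSDCorrelations

variable {S A : Type*}

/-- The correlation `p` as a matrix indexed by question-answer pairs, the feasible point of the
program `ν` attached to `p`. -/
def corrMatrix (p : A → A → S → S → ℝ) : Matrix (S × A) (S × A) ℝ :=
  .of fun i j => p i.2 j.2 i.1 j.1

variable (S A) in
/-- The correlations with positive semidefinite matrix. Together with the synchronous correlation
conditions this is feasibility for the program `ν` over the doubly nonnegative cone. -/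
def psdCorrelations : Set (A → A → S → S → ℝ) :=
  {p | (corrMatrix p).PosSemidef}

variable {p : A → A → S → S → ℝ}

lemma comm_of_mem_psdCorrelations (hpsd : p ∈ psdCorrelations S A) (a b : A) (s t : S) :
    p a b s t = p b a t s :=
  hpsd.isHermitian.apply (t, b) (s, a)

variable [Fintype A]

lemma sum_eq_diag_of_mem_synchronousCorrelations (hp : p ∈ synchronousCorrelations S A) (s : S)
    (a : A) : ∑ b, p a b s s = p a a s s :=
  Fintype.sum_eq_single a fun b hb => hp.2 s a b hb.symm

lemma sum_diag_eq_one_of_mem_synchronousCorrelations (hp : p ∈ synchronousCorrelations S A)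
    (s : S) : ∑ a, p a a s s = 1 := by
  simp only [← sum_eq_diag_of_mem_synchronousCorrelations hp, hp.1.2]

lemma mem_psdCorrelations_of_inner [Finite S] {E : Type*} [NormedAddCommGroup E]
    [InnerProductSpace ℝ E] {x y : S → A → E} (hsync : p ∈ synchronousCorrelations S A)
    (hx : ∀ s, ∑ a, ‖x s a‖ ^ 2 ≤ 1) (hy : ∀ s, ∑ a, ‖y s a‖ ^ 2 ≤ 1)
    (hp : ∀ a b s t, p a b s t = inner ℝ (x s a) (y t b)) : p ∈ psdCorrelations S A := by
  have hxy : x = y := funext fun s => eq_of_sum_norm_sq_le_one_of_sum_inner_eq_one (hx s) (hy s) <|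
    by simpa only [hp] using sum_diag_eq_one_of_mem_synchronousCorrelations hsync s
  have hgram : corrMatrix p = Matrix.gram ℝ (Function.uncurry x) := by
    ext i j
    exact hxy ▸ hp i.2 j.2 i.1 j.1
  change (corrMatrix p).PosSemidef
  exact hgram ▸ Matrix.posSemidef_gram ℝ _

lemma conicCorrelations_doublyNonneg_inter_synchronousCorrelations_subset [Finite S] :
    conicCorrelations (doublyNonneg _) ∩ synchronousCorrelations S A ⊆ psdCorrelations S A := by
  rintro p ⟨⟨X, ⟨hX, hX0⟩, hblock, hp⟩, hsync⟩
  have := Fintype.ofFinite S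
  obtain ⟨v, rfl⟩ := exists_gram_eq_of_posSemidef hX
  have hdiag (u : A → (S × A) ⊕ (S × A))
      (hu : ∑ a, ∑ b, Matrix.gram ℝ v (u a) (u b) = 1) : ∑ a, ‖v (u a)‖ ^ 2 ≤ 1 := by
    simp only [← real_inner_self_eq_norm_sq]
    exact hu ▸ Finset.sum_le_sum fun a _ =>
      Finset.single_le_sum (fun b _ => hX0 (u a) (u b)) (Finset.mem_univ a)
  exact mem_psdCorrelations_of_inner hsync
    (fun s => hdiag (fun a => .inl (s, a)) (hblock (.inl s) (.inl s)))
    (fun s => hdiag (fun a => .inr (s, a)) (hblock (.inr s) (.inr s)))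
    fun a b s t => (hp a b s t).symm

lemma quantumCorrelations_inter_synchronousCorrelations_subset [Finite S] :
    quantumCorrelations S S A A ∩ synchronousCorrelations S A ⊆ psdCorrelations S A := by
  rintro p ⟨⟨m, n, ψ, X, Y, hψ, hX, hX1, hY, hY1, hp⟩, hsync⟩
  have hψ1 : ‖WithLp.toLp 2 ψ‖ ^ 2 = 1 := by
    rw [← inner_self_eq_norm_sq (𝕜 := ℂ), EuclideanSpace.inner_toLp_toLp, dotProduct_comm, hψ]
    simp
  let : InnerProductSpace ℝ (EuclideanSpace ℂ (Fin m × Fin n)) := .complexToReal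
  refine mem_psdCorrelations_of_inner hsync
    (x := fun s a => WithLp.toLp 2 ((X s a ⊗ₖ (1 : Matrix (Fin n) (Fin n) ℂ)) *ᵥ ψ))
    (y := fun t b => WithLp.toLp 2 (((1 : Matrix (Fin m) (Fin m) ℂ) ⊗ₖ Y t b) *ᵥ ψ))
    (fun s => ?_) (fun t => ?_) fun a b s t => ?_
  · refine (sum_norm_sq_mulVec_le (fun a => (hX s a).kronecker .one) ?_ ψ).trans_eq hψ1
    rw [← sum_kronecker, hX1, Matrix.one_kronecker_one]
  · refine (sum_norm_sq_mulVec_le (fun b => Matrix.PosSemidef.one.kronecker (hY t b)) ?_ ψ).trans_eq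
      hψ1
    rw [← kronecker_sum, hY1, Matrix.one_kronecker_one]
  · rw [real_inner_eq_re_inner ℂ, EuclideanSpace.inner_toLp_toLp, dotProduct_comm,
      Matrix.star_mulVec, ((hX s a).kronecker .one).isHermitian.eq, ← Matrix.dotProduct_mulVec,
      Matrix.mulVec_mulVec, ← Matrix.mul_kronecker_mul, Matrix.mul_one, Matrix.one_mul, ← hp]
    simp

lemma sum_eq_diag_of_mem_psdCorrelations [Finite S] (hpsd : p ∈ psdCorrelations S A)
    (hsync : p ∈ synchronousCorrelations S A) (a : A) (s t : S) :
    ∑ b, p a b s t = p a a s s := by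
  have := Fintype.ofFinite S
  obtain ⟨v, hv⟩ := exists_gram_eq_of_posSemidef hpsd
  have hinner (a b : A) (s t : S) : inner ℝ (v (s, a)) (v (t, b)) = p a b s t :=
    congrFun₂ hv (s, a) (t, b)
  have hone (s t : S) : inner ℝ (∑ a, v (s, a)) (∑ b, v (t, b)) = 1 := by
    simp only [inner_sum, sum_inner, hinner]
    rw [Finset.sum_comm, hsync.1.2]
  have hunit : ∑ b, v (t, b) = ∑ b, v (s, b) := by
    rw [← sub_eq_zero, ← inner_self_eq_zero (𝕜 := ℝ), inner_sub_left, inner_sub_right,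
      inner_sub_right]
    simp only [hone, sub_self]
  calc ∑ b, p a b s t = inner ℝ (v (s, a)) (∑ b, v (t, b)) := by simp only [inner_sum, hinner]
    _ = ∑ b, p a b s s := by simp only [hunit, inner_sum, hinner]
    _ = p a a s s := sum_eq_diag_of_mem_synchronousCorrelations hsync s a

end PSDCorrelations

section Questions

variable {S : Type*} [Fintype S]

lemma exists_forall_eq_or_eq_of_card_le_two [Nonempty S] (hS : Fintype.card S ≤ 2) :
    ∃ s₀ s₁ : S, ∀ s, s = s₀ ∨ s = s₁ := by
  obtain ⟨s₀⟩ := ‹Nonempty S›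
  have h := mt Fintype.two_lt_card_iff.2 hS.not_gt
  push Not at h
  by_cases h₁ : ∃ s₁, s₁ ≠ s₀
  · obtain ⟨s₁, h₁⟩ := h₁
    exact ⟨s₀, s₁, fun s => or_iff_not_imp_left.2 fun hs => h s₀ s s₁ (Ne.symm hs) h₁.symm⟩
  · push Not at h₁
    exact ⟨s₀, s₀, fun s => .inl (h₁ s)⟩

lemma nonempty_questions {T A B : Type*} [Fintype T] (G : NonlocalGame S T A B) :
    Nonempty S := by
  by_contra h
  have := not_nonempty_iff.1 h
  simpa using G.π_sum

end Questions

section Deterministic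

variable {S A : Type*}

open Classical in
/-- The correlation of the deterministic strategy in which both players answer `f s` to `s`. -/
noncomputable def detCorr (f : S → A) : A → A → S → S → ℝ :=
  fun a b s t => (if f s = a then 1 else 0) * (if f t = b then 1 else 0)

lemma detCorr_mem_psdCorrelations [Finite S] [Finite A] (f : S → A) :
    detCorr f ∈ psdCorrelations S A := by
  classical
  exact Matrix.posSemidef_vecMulVec_self_star fun i : S × A => if f i.1 = i.2 then (1 : ℝ) else 0

variable [Fintype A]

lemma detCorr_mem_synchronousCorrelations (f : S → A) :
    detCorr f ∈ synchronousCorrelations S A := by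
  classical
  refine ⟨⟨fun a b s t => ?_, fun s t => by simp [detCorr]⟩, fun s a a' h => ?_⟩
  · unfold detCorr
    positivity
  · by_cases ha : f s = a <;> simp [detCorr, ha, h]

lemma detCorr_mem_classicalCorrelations (f : S → A) :
    detCorr f ∈ classicalCorrelations S S A A := by
  classical
  let x (s : S) (_ : Fin 1) (a : A) : ℝ := if f s = a then 1 else 0
  have hx (s : S) (i : Fin 1) (a : A) : 0 ≤ x s i a := by
    unfold x
    positivity
  exact ⟨1, 1, x, x, by simp, hx, hx, by simp, by simp [x], by simp [x], by simp [x, detCorr]⟩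

lemma detCorr_mem_quantumCorrelations (f : S → A) :
    detCorr f ∈ quantumCorrelations S S A A := by
  classical
  let X (s : S) (a : A) : Matrix (Fin 1) (Fin 1) ℂ := if f s = a then 1 else 0
  have hX (s : S) (a : A) : (X s a).PosSemidef := by
    unfold X
    split_ifs
    exacts [.one, .zero]
  refine ⟨1, 1, 1, X, X, by simp [dotProduct], hX, by simp [X], hX, by simp [X],
    fun a b s t => ?_⟩
  by_cases ha : f s = a <;> by_cases hb : f t = b <;> simp [X, detCorr, ha, hb, dotProduct]

lemma detCorr_mem_conicCorrelations {K : Set (Matrix ((S × A) ⊕ (S × A)) ((S × A) ⊕ (S × A)) ℝ)}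
    (hK : completelyPositive _ ⊆ K) (f : S → A) : detCorr f ∈ conicCorrelations K :=
  conicCorrelations_mono hK <|
    classicalCorrelations_subset_conicCorrelations_completelyPositive
      (detCorr_mem_classicalCorrelations f)

lemma mem_convexHull_range_detCorr {s₀ s₁ : S} (hS : ∀ s, s = s₀ ∨ s = s₁)
    {p : A → A → S → S → ℝ} (hpsd : p ∈ psdCorrelations S A)
    (hsync : p ∈ synchronousCorrelations S A) : p ∈ convexHull ℝ (Set.range detCorr) := by
  classical
  have : Finite S := Set.finite_univ_iff.1 <|
    (Set.toFinite {s₀, s₁}).subset fun s _ => by simpa using hS s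
  have hcomm := comm_of_mem_psdCorrelations hpsd
  have hrow := sum_eq_diag_of_mem_psdCorrelations hpsd hsync
  have hcol (b : A) (s t : S) : ∑ a, p a b s t = p b b t t := by
    simp only [hcomm _ b, hrow]
  have hdiag (a b : A) (s : S) : p a b s s = if b = a then p b b s s else 0 := by
    split_ifs with h
    exacts [h ▸ rfl, hsync.2 s a b (Ne.symm h)]
  let g (c : A × A) (s : S) : A := if s = s₀ then c.1 else c.2
  refine mem_convexHull_of_exists_fintype (fun c : A × A => p c.1 c.2 s₀ s₁)
    (fun c => detCorr (g c)) (fun c => hsync.1.1 _ _ _ _)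
    (by rw [Fintype.sum_prod_type, hsync.1.2]) (fun c => ⟨g c, rfl⟩) ?_
  ext a b s t
  simp only [Finset.sum_apply, Pi.smul_apply, smul_eq_mul, Fintype.sum_prod_type, detCorr, g]
  rcases eq_or_ne s s₀ with hs | hs <;> rcases eq_or_ne t s₀ with ht | ht
  · simp only [hs, ht, if_true, ← Finset.sum_mul, hrow, hdiag a b]
    simp
  · obtain rfl := (hS t).resolve_left ht
    simp [hs, ht]
  · obtain rfl := (hS s).resolve_left hs
    simp [hs, ht, hcomm a b]
  · obtain rfl := (hS s).resolve_left hs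
    obtain rfl := (hS t).resolve_left ht
    rw [Finset.sum_comm]
    simp only [hs, if_false, ← Finset.sum_mul, hcol, hdiag a b]
    simp

end Deterministic

section Values

variable {S A : Type*} [Fintype S] [Fintype A]

lemma isLinearMap_winProb {T B : Type*} [Fintype T] [Fintype B] (G : NonlocalGame S T A B) :
    IsLinearMap ℝ G.winProb where
  map_add p q := by
    simp only [winProb, Pi.add_apply, mul_add, Finset.sum_add_distrib]
  map_smul c p := by
    simp only [winProb, Pi.smul_apply, smul_eq_mul, Finset.mul_sum, mul_left_comm _ c]

/-- The largest winning probability of a deterministic strategy in which both players use the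
same function, with junk value `0` when there are no answers. -/
noncomputable def deterministicValue (G : NonlocalGame S S A A) : ℝ :=
  ⨆ f : S → A, G.winProb (detCorr f)

lemma winProb_detCorr_le_deterministicValue (G : NonlocalGame S S A A) (f : S → A) :
    G.winProb (detCorr f) ≤ G.deterministicValue :=
  le_ciSup (Set.finite_range fun f => G.winProb (detCorr f)).bddAbove f

lemma winProb_le_deterministicValue (G : NonlocalGame S S A A) {p : A → A → S → S → ℝ}
    (hp : p ∈ convexHull ℝ (Set.range detCorr)) : G.winProb p ≤ G.deterministicValue := by
  refine convexHull_min ?_ (convex_halfSpace_le G.isLinearMap_winProb _) hp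
  rintro _ ⟨f, rfl⟩
  exact G.winProb_detCorr_le_deterministicValue f

lemma isGreatest_syncWinProbs [Nonempty A] (hS : Fintype.card S ≤ 2) (G : NonlocalGame S S A A)
    {𝒮 : Set (A → A → S → S → ℝ)} (hdet : ∀ f, detCorr f ∈ 𝒮)
    (hpsd : 𝒮 ∩ synchronousCorrelations S A ⊆ psdCorrelations S A) :
    IsGreatest (G.syncWinProbs 𝒮) G.deterministicValue := by
  have := G.nonempty_questions
  obtain ⟨s₀, s₁, hs⟩ := exists_forall_eq_or_eq_of_card_le_two hS
  constructor
  · obtain ⟨f, hf⟩ := exists_eq_ciSup_of_finite (f := fun f : S → A => G.winProb (detCorr f))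
    exact ⟨detCorr f, ⟨hdet f, detCorr_mem_synchronousCorrelations f⟩, hf⟩
  · rintro _ ⟨p, hp, rfl⟩
    exact G.winProb_le_deterministicValue (mem_convexHull_range_detCorr hs (hpsd hp) hp.2)

lemma half_trace_mul_corrMatrix (G : NonlocalGame S S A A) {p : A → A → S → S → ℝ}
    (hp : p ∈ psdCorrelations S A) :
    (1 / 2 : ℝ) * ((G.costMatrix + G.costMatrixᵀ) * corrMatrix p).trace = G.winProb p := by
  have hsymm : (corrMatrix p)ᵀ = corrMatrix p := by
    simpa using hp.isHermitian.eq
  have htranspose : (G.costMatrixᵀ * corrMatrix p).trace = G.winProb p := by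
    rw [Matrix.trace_mul_comm, ← Matrix.sum_hadamard_eq]
    simp only [Fintype.sum_prod_type, Matrix.hadamard_apply, corrMatrix, costMatrix,
      Matrix.of_apply, winProb, Finset.mul_sum]
    refine Finset.sum_congr rfl fun s _ => ?_
    rw [Finset.sum_comm]
    exact Finset.sum_congr rfl fun t _ => Finset.sum_congr rfl fun a _ =>
      Finset.sum_congr rfl fun b _ => by ring
  have hcost : (G.costMatrix * corrMatrix p).trace = (G.costMatrixᵀ * corrMatrix p).trace := by
    rw [← Matrix.trace_transpose, Matrix.transpose_mul, hsymm, Matrix.trace_mul_comm]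
  rw [Matrix.add_mul, Matrix.trace_add, hcost, htranspose]
  ring

lemma nuValues_doublyNonneg (G : NonlocalGame S S A A) :
    nuValues (doublyNonneg _) G = G.syncWinProbs (psdCorrelations S A) := by
  ext r
  constructor
  · rintro ⟨X, ⟨⟨hX, hX0⟩, hsum, hzero⟩, rfl⟩
    exact ⟨fun a b s t => X (s, a) (t, b), ⟨hX, ⟨fun _ _ _ _ => hX0 _ _, hsum⟩, hzero⟩,
      (G.half_trace_mul_corrMatrix hX).symm⟩
  · rintro ⟨p, ⟨hpsd, ⟨hp0, hsum⟩, hzero⟩, rfl⟩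
    exact ⟨corrMatrix p, ⟨⟨hpsd, fun _ _ => hp0 _ _ _ _⟩, hsum, hzero⟩,
      G.half_trace_mul_corrMatrix hpsd⟩

section TwoQuestions

variable [Nonempty A]

lemma isGreatest_syncWinProbs_conicCorrelations (hS : Fintype.card S ≤ 2)
    (G : NonlocalGame S S A A)
    {K : Set (Matrix ((S × A) ⊕ (S × A)) ((S × A) ⊕ (S × A)) ℝ)}
    (hCP : completelyPositive _ ⊆ K) (hDNN : K ⊆ doublyNonneg _) :
    IsGreatest (G.syncWinProbs (conicCorrelations K)) G.deterministicValue :=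
  isGreatest_syncWinProbs hS G (detCorr_mem_conicCorrelations hCP) <|
    (Set.inter_subset_inter_left _ (conicCorrelations_mono hDNN)).trans
      conicCorrelations_doublyNonneg_inter_synchronousCorrelations_subset

lemma isGreatest_syncWinProbs_completelyPositive (hS : Fintype.card S ≤ 2)
    (G : NonlocalGame S S A A) :
    IsGreatest (G.syncWinProbs (conicCorrelations (completelyPositive _))) G.deterministicValue :=
  isGreatest_syncWinProbs_conicCorrelations hS G subset_rfl
    (completelyPositive_subset_completelyPSD.trans completelyPSD_subset_doublyNonneg)

lemma isGreatest_syncWinProbs_completelyPSD (hS : Fintype.card S ≤ 2)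
    (G : NonlocalGame S S A A) :
    IsGreatest (G.syncWinProbs (conicCorrelations (completelyPSD _))) G.deterministicValue :=
  isGreatest_syncWinProbs_conicCorrelations hS G completelyPositive_subset_completelyPSD
    completelyPSD_subset_doublyNonneg

lemma isGreatest_syncWinProbs_classicalCorrelations (hS : Fintype.card S ≤ 2)
    (G : NonlocalGame S S A A) :
    IsGreatest (G.syncWinProbs (classicalCorrelations S S A A)) G.deterministicValue :=
  isGreatest_syncWinProbs hS G detCorr_mem_classicalCorrelations <|
    (Set.inter_subset_inter_left _
      (classicalCorrelations_subset_conicCorrelations_completelyPositive.trans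
        (conicCorrelations_mono
          (completelyPositive_subset_completelyPSD.trans completelyPSD_subset_doublyNonneg)))).trans
      conicCorrelations_doublyNonneg_inter_synchronousCorrelations_subset

lemma isGreatest_syncWinProbs_quantumCorrelations (hS : Fintype.card S ≤ 2)
    (G : NonlocalGame S S A A) :
    IsGreatest (G.syncWinProbs (quantumCorrelations S S A A)) G.deterministicValue :=
  isGreatest_syncWinProbs hS G detCorr_mem_quantumCorrelations
    quantumCorrelations_inter_synchronousCorrelations_subset

lemma isGreatest_nuValues_doublyNonneg (hS : Fintype.card S ≤ 2)
    (G : NonlocalGame S S A A) :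
    IsGreatest (nuValues (doublyNonneg _) G) G.deterministicValue :=
  G.nuValues_doublyNonneg ▸
    isGreatest_syncWinProbs hS G detCorr_mem_psdCorrelations Set.inter_subset_left

end TwoQuestions

end Values

section CHSH

lemma winProb_chsh_detCorr (f : Bool → Bool) :
    chsh.winProb (detCorr f) = if f false = f true then 3 / 4 else 1 / 4 := by
  cases hf₀ : f false <;> cases hf₁ : f true <;>
    simp [winProb, chsh, detCorr, hf₀, hf₁] <;> norm_num

lemma deterministicValue_chsh : chsh.deterministicValue = 3 / 4 := by
  refine le_antisymm (ciSup_le fun f => ?_) ?_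
  · rw [winProb_chsh_detCorr]
    split_ifs <;> norm_num
  · simpa [winProb_chsh_detCorr] using
      chsh.winProb_detCorr_le_deterministicValue fun _ => false

lemma syncValue_chsh_quantumCorrelations :
    chsh.syncValue (quantumCorrelations Bool Bool Bool Bool) = 3 / 4 :=
  (isGreatest_syncWinProbs_quantumCorrelations le_rfl chsh).csSup_eq.trans deterministicValue_chsh

lemma syncValue_chsh_classicalCorrelations :
    chsh.syncValue (classicalCorrelations Bool Bool Bool Bool) = 3 / 4 :=
  (isGreatest_syncWinProbs_classicalCorrelations le_rfl chsh).csSup_eq.trans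
    deterministicValue_chsh

lemma conicSyncValue_completelyPSD_chsh : conicSyncValue (completelyPSD _) chsh = 3 / 4 :=
  (isGreatest_syncWinProbs_completelyPSD le_rfl chsh).csSup_eq.trans deterministicValue_chsh

end CHSH

end NonlocalGame

theorem corollary5p7_general {S A : Type*} [Fintype S] [Fintype A] [Nonempty A]
    (hS : Fintype.card S ≤ 2) (G : NonlocalGame S S A A) :
    (conicSyncValue (completelyPositive _) G = conicSyncValue (completelyPSD _) G ∧
      conicSyncValue (completelyPSD _) G = nu (doublyNonneg _) G) ∧
    (G.syncValue (classicalCorrelations S S A A) = G.syncValue (quantumCorrelations S S A A) ∧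
      G.syncValue (quantumCorrelations S S A A) = nu (doublyNonneg _) G) ∧
    IsGreatest (G.syncWinProbs (conicCorrelations (completelyPositive _)))
      (conicSyncValue (completelyPositive _) G) ∧
    IsGreatest (G.syncWinProbs (conicCorrelations (completelyPSD _)))
      (conicSyncValue (completelyPSD _) G) ∧
    IsGreatest (G.syncWinProbs (classicalCorrelations S S A A))
      (G.syncValue (classicalCorrelations S S A A)) ∧
    IsGreatest (G.syncWinProbs (quantumCorrelations S S A A))
      (G.syncValue (quantumCorrelations S S A A)) ∧
    IsGreatest (nuValues (doublyNonneg _) G) (nu (doublyNonneg _) G) := by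
  have hCP := isGreatest_syncWinProbs_completelyPositive hS G
  have hCS := isGreatest_syncWinProbs_completelyPSD hS G
  have hC := isGreatest_syncWinProbs_classicalCorrelations hS G
  have hQ := isGreatest_syncWinProbs_quantumCorrelations hS G
  have hν := isGreatest_nuValues_doublyNonneg hS G
  simp only [conicSyncValue, syncValue, nu, hCP.csSup_eq, hCS.csSup_eq, hC.csSup_eq, hQ.csSup_eq,
    hν.csSup_eq, and_self, true_and]
  exact ⟨hCP, hCS, hC, hQ, hν⟩

theorem corollary5p7 :
    (∀ (S A : Type*) [Fintype S] [Fintype A], Fintype.card S = 2 → Fintype.card A = 2 →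
      ∀ G : NonlocalGame S S A A,
        -- the synchronous classical and quantum values agree with the value of the SDP
        (conicSyncValue (completelyPositive _) G = conicSyncValue (completelyPSD _) G ∧
          conicSyncValue (completelyPSD _) G = nu (doublyNonneg _) G) ∧
        (G.syncValue (classicalCorrelations S S A A) = G.syncValue (quantumCorrelations S S A A) ∧
          G.syncValue (quantumCorrelations S S A A) = nu (doublyNonneg _) G) ∧
        -- all these suprema are attained
        IsGreatest (G.syncWinProbs (conicCorrelations (completelyPositive _)))
          (conicSyncValue (completelyPositive _) G) ∧
        IsGreatest (G.syncWinProbs (conicCorrelations (completelyPSD _)))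
          (conicSyncValue (completelyPSD _) G) ∧
        IsGreatest (G.syncWinProbs (classicalCorrelations S S A A))
          (G.syncValue (classicalCorrelations S S A A)) ∧
        IsGreatest (G.syncWinProbs (quantumCorrelations S S A A))
          (G.syncValue (quantumCorrelations S S A A)) ∧
        IsGreatest (nuValues (doublyNonneg _) G) (nu (doublyNonneg _) G)) ∧
    -- the CHSH game
    chsh.syncValue (quantumCorrelations Bool Bool Bool Bool) = 3 / 4 ∧
    chsh.syncValue (classicalCorrelations Bool Bool Bool Bool) = 3 / 4 ∧
    conicSyncValue (completelyPSD _) chsh = 3 / 4 :=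
  ⟨fun _ _ _ _ hS hA G =>
      have := Fintype.card_pos_iff.1 (hA.symm ▸ two_pos)
      corollary5p7_general hS.le G,
    syncValue_chsh_quantumCorrelations, syncValue_chsh_classicalCorrelations,
    conicSyncValue_completelyPSD_chsh⟩
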